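/- Let $T$ be the rooted binary tree, let $\mathrm{Aut}\,T$ be its automorphism group, and let $\mathrm{st}(n)\leq \mathrm{Aut}\,T$ be the pointwise stabilizer of level $n$. Let $\psi:\mathrm{st}(1)\to \mathrm{Aut}\,T\times\mathrm{Aut}\,T$ be the isomorphism given by restriction to the two subtrees rooted at the first level, write $(g,h)$ for $\psi^{-1}(g,h)$, and let $\varepsilon$ be the swap of these two subtrees. Let $G=\langle a,b\rangle\leq\mathrm{Aut}\,T$ be the Basilica group, where $a,b$ are defined recursively by $a=(1,b)$ and $b=(1,a)\varepsilon$. Write $G'=[G,G]$ and $\gamma_3(G)=[G',G]$. For a subgroup $K\leq \mathrm{Aut}\,T$ put $\mathrm{st}_K(n)=K\cap\mathrm{st}(n)$. Say that $K$ has the congruence subgroup property (CSP) if every finite index subgroup of $K$ contains some $\mathrm{st}_K(n)$. Say that $K$ has the $2$-CSP if every $N\trianglelefteq K$ such that $K/N$ is a finite $2$-group contains some $\mathrm{st}_K(n)$. For $M\trianglelefteq K$, say that $K$ has the $2$-CSP modulo $M$ if every $N\trianglelefteq K$ such that $N\geq M$ and $K/N$ is a finite $2$-group contains some $\mathrm{st}_K(n)$.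 Then: 1. $G$ has the $2$-CSP; 2. $G$ does not have the CSP; 3. $G/G'\cong\mathbb{Z}^2$; 4. $G$ has the $2$-CSP modulo $\gamma_3(G)$; 5. $\psi^{-1}(\gamma_3(G)\times\gamma_3(G))$ is a normal subgroup of $\gamma_3(G)$, and $\gamma_3(G)$ has the $2$-CSP modulo it. -/

import Mathlib

/-- The automorphism group of the regular rooted tree whose vertices are the finite words over `X`,
the root being the empty word and the words `v ++ [x]` being the children of `v`: the permutations
of the vertices that preserve levels and the relation of being an ancestor. -/
def treeAut (X : Type) : Subgroup (Equiv.Perm (List X)) where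
  carrier := {g | ∀ u, (g u).length = u.length ∧ ∀ v, g u <+: g v ↔ u <+: v}
  mul_mem' := by
    intro g h hg hh u
    refine ⟨?_, fun v => ?_⟩
    · simp only [Equiv.Perm.coe_mul, Function.comp_apply]
      rw [(hg (h u)).1, (hh u).1]
    · simp only [Equiv.Perm.coe_mul, Function.comp_apply]
      rw [(hg (h u)).2 (h v), (hh u).2 v]
  one_mem' := fun u => ⟨rfl, fun v => Iff.rfl⟩
  inv_mem' := by
    intro g hg u
    refine ⟨?_, fun v => ?_⟩
    · have h := (hg (g⁻¹ u)).1
      simpa using h.symm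
    · have h := (hg (g⁻¹ u)).2 (g⁻¹ v)
      simpa using h.symm

/-- The `n`-th level stabilizer in the full automorphism group of the tree. -/
def levelStab (X : Type) (n : ℕ) : Subgroup (treeAut X) where
  carrier := {g | ∀ v : List X, v.length = n → g.1 v = v}
  mul_mem' := by
    intro g h hg hh v hv
    have h1 : h.1 v = v := hh v hv
    have h2 : g.1 v = v := hg v hv
    simp [h1, h2]
  one_mem' := fun v _ => rfl
  inv_mem' := by
    intro g hg v hv
    have h1 : g.1 v = v := hg v hv
    change g.1⁻¹ v = v
    rw [Equiv.Perm.inv_eq_iff_eq]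
    exact h1.symm

/-- The level stabilizer `st_G(n)`, a subgroup of the group `G` of tree automorphisms. -/
def levelStabIn {X : Type} (G : Subgroup (treeAut X)) (n : ℕ) : Subgroup G :=
  (levelStab X n).subgroupOf G

/-- The congruence subgroup property: every subgroup of finite index contains a level stabilizer. -/
def HasCSP {X : Type} (G : Subgroup (treeAut X)) : Prop :=
  ∀ H : Subgroup G, H.FiniteIndex → ∃ n : ℕ, levelStabIn G n ≤ H

/-- The `C`-congruence subgroup property for a class `C` of groups: every normal subgroup `N` of `G`
with `G ⧸ N` in `C` contains a level stabilizer. -/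
def HasClassCSP {X : Type} (C : ∀ (Q : Type) [Group Q], Prop) (G : Subgroup (treeAut X)) : Prop :=
  ∀ (N : Subgroup G) [N.Normal], C (G ⧸ N) → ∃ n : ℕ, levelStabIn G n ≤ N

/-- `M` is a normal subgroup of `G`, and `G` has the `C`-congruence subgroup property modulo `M`:
every normal subgroup `N` of `G` that contains `M` and has `G ⧸ N` in `C` contains a level
stabilizer. -/
def HasClassCSPMod {X : Type} (C : ∀ (Q : Type) [Group Q], Prop)
    (G M : Subgroup (treeAut X)) : Prop :=
  M ≤ G ∧ (M.subgroupOf G).Normal ∧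
    ∀ (N : Subgroup G) [N.Normal], C (G ⧸ N) → M.subgroupOf G ≤ N →
      ∃ n : ℕ, levelStabIn G n ≤ N

/-- The class of all finite `p`-groups. -/
def IsFinitePGroup (p : ℕ) (Q : Type) [Group Q] : Prop :=
  Finite Q ∧ IsPGroup p Q

/-- The map on vertices of the binary tree that fixes the two vertices of level one (`false` is the
first, `true` the second) and acts as `f` below the first and as `g` below the second. -/
def pairFun (f g : List Bool → List Bool) : List Bool → List Bool
  | [] => []
  | false :: v => false :: f v
  | true :: v => true :: g v

/-- The automorphism `(f, g)` of the binary tree, as a homomorphism `Aut T × Aut T →* Aut T`. It is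
the inverse of the isomorphism from the stabilizer of level one to `Aut T × Aut T`, so that the
image of a subgroup `H × K` under it is the preimage of `H × K` under that isomorphism. -/
def pairHom : treeAut Bool × treeAut Bool →* treeAut Bool where
  toFun p :=
    ⟨{  toFun := pairFun p.1.1 p.2.1
        invFun := pairFun p.1.1.symm p.2.1.symm
        left_inv := by rintro (_ | ⟨_ | _, v⟩) <;> simp [pairFun]
        right_inv := by rintro (_ | ⟨_ | _, v⟩) <;> simp [pairFun] }, by
      rintro (_ | ⟨_ | _, u⟩)
      · refine ⟨rfl, fun v => ?_⟩
        simp [pairFun]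
      · refine ⟨by simp [pairFun, (p.1.2 u).1], ?_⟩
        rintro (_ | ⟨_ | _, v⟩) <;> simp [pairFun, (p.1.2 u).2]
      · refine ⟨by simp [pairFun, (p.2.2 u).1], ?_⟩
        rintro (_ | ⟨_ | _, v⟩) <;> simp [pairFun, (p.2.2 u).2]⟩
  map_one' := by
    apply Subtype.ext
    apply Equiv.ext
    rintro (_ | ⟨_ | _, v⟩) <;> rfl
  map_mul' := by
    intro p q
    apply Subtype.ext
    apply Equiv.ext
    rintro (_ | ⟨_ | _, v⟩) <;> rfl

theorem pairHom_injective : Function.Injective pairHom := by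
  rintro ⟨f, g⟩ ⟨f', g'⟩ h
  have h' : ∀ v, pairFun f.1 g.1 v = pairFun f'.1 g'.1 v := fun v =>
    congrArg (fun k : treeAut Bool => k.1 v) h
  refine Prod.ext (Subtype.ext (Equiv.ext fun v => ?_)) (Subtype.ext (Equiv.ext fun v => ?_))
  · simpa [pairFun] using h' (false :: v)
  · simpa [pairFun] using h' (true :: v)

theorem levelStab_one_cons (g : treeAut Bool) (hg : g ∈ levelStab Bool 1) (x : Bool) (v : List Bool) :
    g.1 (x :: v) = x :: (g.1 (x :: v)).tail := by
  have h1 : g.1 [x] = [x] := hg [x] rfl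
  have h2 := ((g.2 [x]).2 (x :: v)).2 (by simp)
  rw [h1] at h2
  obtain ⟨t, ht⟩ := h2
  rw [← ht]; rfl

/-- The automorphisms of the form `(f, g)` are exactly those that fix level one. -/
theorem pairHom_range : pairHom.range = levelStab Bool 1 := by
  ext g
  constructor
  · rintro ⟨p, rfl⟩ v hv
    match v, hv with
    | [false], _ => simpa [pairHom, pairFun] using (p.1.2 []).1
    | [true], _ => simpa [pairHom, pairFun] using (p.2.2 []).1
  · intro hg
    have hi : g⁻¹ ∈ levelStab Bool 1 := inv_mem hg
    let s : Bool → treeAut Bool := fun x =>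
      ⟨⟨fun v => (g.1 (x :: v)).tail, fun v => ((g⁻¹).1 (x :: v)).tail,
        fun v => by beta_reduce; rw [← levelStab_one_cons g hg]; simp, fun v => by beta_reduce; rw [← levelStab_one_cons g⁻¹ hi]; simp⟩, by
        intro u
        refine ⟨?_, fun v => ?_⟩
        · have := (g.2 (x :: u)).1
          simp [this]
        · have := (g.2 (x :: u)).2 (x :: v)
          rw [levelStab_one_cons g hg x u, levelStab_one_cons g hg x v] at this
          simpa using this⟩
    refine ⟨(s false, s true), ?_⟩
    apply Subtype.ext
    apply Equiv.ext
    rintro (_ | ⟨_ | _, v⟩)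
    · have := (g.2 []).1
      simp at this
      change [] = _
      simp [this]
    · exact (levelStab_one_cons g hg false v).symm
    · exact (levelStab_one_cons g hg true v).symm

/-- The vertex map of the swap `ε` at the root. -/
def swapFun : List Bool → List Bool
  | [] => []
  | x :: v => (!x) :: v

/-- The automorphism `ε` that swaps the two subtrees at the root. -/
def rootSwap : treeAut Bool :=
  ⟨{  toFun := swapFun
      invFun := swapFun
      left_inv := by rintro (_ | ⟨_ | _, v⟩) <;> rfl
      right_inv := by rintro (_ | ⟨_ | _, v⟩) <;> rfl }, by
    rintro (_ | ⟨x, u⟩)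
    · exact ⟨rfl, fun v => by simp [swapFun]⟩
    · refine ⟨by simp [swapFun], ?_⟩
      rintro (_ | ⟨y, v⟩) <;> simp [swapFun]⟩

mutual
/-- The vertex map of the generator `a = (1, b)`. -/
def basilicaAFun : List Bool → List Bool
  | [] => []
  | false :: v => false :: v
  | true :: v => true :: basilicaBFun v
/-- The vertex map of the generator `b = (1, a) ε`. -/
def basilicaBFun : List Bool → List Bool
  | [] => []
  | false :: v => true :: basilicaAFun v
  | true :: v => false :: v
end

mutual
/-- The inverse of the vertex map of `a`. -/
def basilicaAInv : List Bool → List Bool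
  | [] => []
  | false :: v => false :: v
  | true :: v => true :: basilicaBInv v
/-- The inverse of the vertex map of `b`. -/
def basilicaBInv : List Bool → List Bool
  | [] => []
  | false :: v => true :: v
  | true :: v => false :: basilicaAInv v
end

theorem basilica_inverse (v : List Bool) :
    (basilicaAInv (basilicaAFun v) = v ∧ basilicaBInv (basilicaBFun v) = v) ∧
      (basilicaAFun (basilicaAInv v) = v ∧ basilicaBFun (basilicaBInv v) = v) := by
  induction v with
  | nil => simp [basilicaAFun, basilicaBFun, basilicaAInv, basilicaBInv]
  | cons x v ih =>
    cases x <;> simp [basilicaAFun, basilicaBFun, basilicaAInv, basilicaBInv, ih]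

theorem basilica_mem (u : List Bool) :
    ((basilicaAFun u).length = u.length ∧ ∀ v, basilicaAFun u <+: basilicaAFun v ↔ u <+: v) ∧
      ((basilicaBFun u).length = u.length ∧ ∀ v, basilicaBFun u <+: basilicaBFun v ↔ u <+: v) := by
  induction u with
  | nil => simp [basilicaAFun, basilicaBFun]
  | cons x u ih =>
    cases x <;> refine ⟨⟨by simp [basilicaAFun, ih], ?_⟩, ⟨by simp [basilicaBFun, ih], ?_⟩⟩ <;>
      rintro (_ | ⟨_ | _, v⟩) <;> simp [basilicaAFun, basilicaBFun, ih]

/-- The generator `a` of the Basilica group. -/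
def basilicaA : treeAut Bool :=
  ⟨⟨basilicaAFun, basilicaAInv, fun v => (basilica_inverse v).1.1,
    fun v => (basilica_inverse v).2.1⟩, fun u => (basilica_mem u).1⟩

/-- The generator `b` of the Basilica group. -/
def basilicaB : treeAut Bool :=
  ⟨⟨basilicaBFun, basilicaBInv, fun v => (basilica_inverse v).1.2,
    fun v => (basilica_inverse v).2.2⟩, fun u => (basilica_mem u).2⟩

/-- `a = (1, b)`. -/
theorem basilicaA_eq : basilicaA = pairHom (1, basilicaB) := by
  apply Subtype.ext
  apply Equiv.ext
  rintro (_ | ⟨_ | _, v⟩) <;> rfl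

/-- `b = (1, a) ε`. -/
theorem basilicaB_eq : basilicaB = pairHom (1, basilicaA) * rootSwap := by
  apply Subtype.ext
  apply Equiv.ext
  rintro (_ | ⟨_ | _, v⟩) <;> rfl

/-- The Basilica group `G = ⟨a, b⟩`. -/
def basilica : Subgroup (treeAut Bool) :=
  Subgroup.closure {basilicaA, basilicaB}

/-- The third term `γ₃(G) = [[G, G], G]` of the lower central series of the Basilica group (the
series in Mathlib starts with index `0`), as a group of tree automorphisms. -/
def basilicaGamma3 : Subgroup (treeAut Bool) :=
  basilica.lowerCentralSeries 2

/-- The group `ψ⁻¹(γ₃(G) × γ₃(G))` of all automorphisms `(g, h)` with `g` and `h` in `γ₃(G)`. -/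
def basilicaGamma3Square : Subgroup (treeAut Bool) :=
  (basilicaGamma3.prod basilicaGamma3).map pairHom

-- The quotient `G/γ₃(G)` is the discrete Heisenberg group, and level stabilizers are visible in its
-- coordinates. If `(g, h)` lies in `G`, then `g` and `h` have the same exponent of `a`, and the
-- coordinates of `(g, h)` are an explicit function `fold` of those of `g` and `h`. Iterating `fold`
-- shows that elements of `st(2k)` have all coordinates divisible by `2^k` (`dvd_of_mem_levelStab`).
-- This does two jobs. It makes the coordinates well defined, since an element over `1` has
-- coordinates divisible by every power of two. It also gives the 2-CSP modulo `γ₃(G)`, since a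
-- finite 2-group quotient has exponent a power of two. The coordinates further give the
-- abelianization, and the CSP fails because a quotient of order 3 survives although every level
-- quotient is a 2-group.
--
-- Modulo `γ₃ × γ₃`, the group `γ₃` is generated by two elements whose exponents can be read off
-- from the coordinates of the sections; the same divisibility then gives `gamma3_classCSPMod`.
--
-- For the full 2-CSP, let `K_m` be the group of elements fixing level `m` with all sections there
-- in `γ₃`. The relation `([[a,b],b], 1) ∈ [G',G'] ≤ γ₄` starts an induction that yields `K_m ≤
-- γ_{m+3}` (`gamma3Power_le_lowerCentralSeries`). A finite 2-group is nilpotent, so its kernel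
-- contains some `K_m`, and the 2-CSP modulo each successive factor of the chain `G ≥ K_0 ≥ K_1 ≥
-- ...` can be assembled.

open scoped commutatorElement

-- The Heisenberg group and the recursion for its coordinates.

/-- The discrete Heisenberg group, as triples of integers. -/
@[ext]
structure Heisenberg where
  x : ℤ
  y : ℤ
  z : ℤ

namespace Heisenberg

instance : Mul Heisenberg := ⟨fun h k => ⟨h.x + k.x, h.y + k.y, h.z + k.z + h.x * k.y⟩⟩
instance : One Heisenberg := ⟨⟨0, 0, 0⟩⟩
instance : Inv Heisenberg := ⟨fun h => ⟨-h.x, -h.y, -h.z + h.x * h.y⟩⟩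

@[simp] theorem mul_x (h k : Heisenberg) : (h * k).x = h.x + k.x := rfl
@[simp] theorem mul_y (h k : Heisenberg) : (h * k).y = h.y + k.y := rfl
@[simp] theorem mul_z (h k : Heisenberg) : (h * k).z = h.z + k.z + h.x * k.y := rfl
@[simp] theorem one_x : (1 : Heisenberg).x = 0 := rfl
@[simp] theorem one_y : (1 : Heisenberg).y = 0 := rfl
@[simp] theorem one_z : (1 : Heisenberg).z = 0 := rfl
@[simp] theorem inv_x (h : Heisenberg) : (h⁻¹).x = -h.x := rfl
@[simp] theorem inv_y (h : Heisenberg) : (h⁻¹).y = -h.y := rfl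
@[simp] theorem inv_z (h : Heisenberg) : (h⁻¹).z = -h.z + h.x * h.y := rfl

instance : Group Heisenberg :=
  Group.ofLeftAxioms
    (by intro a b c; ext <;> simp <;> ring)
    (by intro a; ext <;> simp)
    (by intro a; ext <;> simp)

/-- The image of `a`. -/
def α : Heisenberg := ⟨1, 0, 0⟩

/-- The image of `b`. -/
def β : Heisenberg := ⟨0, 1, 0⟩

/-- The expression of the Heisenberg coordinates of `(g, h)` through those of `g` and `h`. -/
def fold (h k : Heisenberg) : Heisenberg :=
  ⟨h.y + k.y, 2 * h.x, 2 * h.x * (h.y + k.y) - h.y - 2 * (h.z + k.z)⟩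

/-- The cross terms cancel because the first coordinates agree: on the subgroup of such pairs `fold`
is a homomorphism. Sections of elements of `G` satisfy this condition. -/
theorem fold_mul {h k h' k' : Heisenberg} (e : h.x = k.x) :
    fold (h * h') (k * k') = fold h k * fold h' k' := by
  ext <;> simp [fold] <;> try simp only [e]
  all_goals ring

theorem fold_inv {h k : Heisenberg} (e : h.x = k.x) : fold h⁻¹ k⁻¹ = (fold h k)⁻¹ := by
  ext <;> simp [fold] <;> try simp only [e]
  all_goals ring

/-- Counterpart in coordinates of `b (g, h) b⁻¹ = (h, a g a⁻¹)`. -/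
theorem fold_conj {h k : Heisenberg} (e : h.x = k.x) :
    fold k (α * h * α⁻¹) = β * fold h k * β⁻¹ := by
  ext <;> simp [fold, α, β] <;> try simp only [e]
  all_goals ring

theorem fold_conj_inv {h k : Heisenberg} (e : h.x = k.x) :
    fold (α⁻¹ * k * α) h = β⁻¹ * fold h k * β := by
  ext <;> simp [fold, α, β] <;> try simp only [e]
  all_goals ring

/-- The coordinates of `h` are divisible by `d`. -/
def DvdCoords (d : ℤ) (h : Heisenberg) : Prop := d ∣ h.x ∧ d ∣ h.y ∧ d ∣ h.z

theorem eq_one_of_forall_dvd {h : Heisenberg} (H : ∀ k : ℕ, DvdCoords (2 ^ k) h) : h = 1 := by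
  have key : ∀ m : ℤ, (∀ k : ℕ, (2 : ℤ) ^ k ∣ m) → m = 0 := by
    intro m hm
    refine Int.eq_zero_of_abs_lt_dvd (hm m.natAbs) ?_
    rw [Int.abs_eq_natAbs]
    exact_mod_cast Nat.lt_two_pow_self
  ext
  · exact key _ fun k => (H k).1
  · exact key _ fun k => (H k).2.1
  · exact key _ fun k => (H k).2.2

/-- Two elements whose commutator is central in the group they generate give a homomorphism from
the Heisenberg group. -/
def lift {Q : Type*} [Group Q] (a b : Q) (ha : Commute ⁅a, b⁆ a) (hb : Commute ⁅a, b⁆ b) :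
    Heisenberg →* Q where
  toFun h := b ^ h.y * a ^ h.x * ⁅a, b⁆ ^ h.z
  map_one' := by simp
  map_mul' h k := by
    set c := ⁅a, b⁆ with hc
    have h1 : a * b * a⁻¹ = c * b := by rw [hc, commutatorElement_def]; group
    have h2 (y : ℤ) : a * b ^ y * a⁻¹ = c ^ y * b ^ y := by
      rw [← conj_zpow, h1, hb.mul_zpow]
    have h3 (y : ℤ) : (b ^ y)⁻¹ * a * b ^ y = c ^ y * a := by
      have := h2 y
      have h4 : Commute (c ^ y) (b ^ y) := hb.zpow_zpow y y
      rw [mul_inv_eq_iff_eq_mul] at this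
      rw [mul_assoc, this, h4.eq]
      group
    have h4 (x y : ℤ) : (b ^ y)⁻¹ * a ^ x * b ^ y = c ^ (x * y) * a ^ x := by
      have h5 := conj_zpow (i := x) (a := (b ^ y)⁻¹) (b := a)
      rw [inv_inv, h3, (ha.zpow_left y).mul_zpow, ← zpow_mul, mul_comm y x] at h5
      exact h5.symm
    -- Moving `a^x` past `b^y` costs `c^(xy)`, which is the cross term in the third coordinate of a
    -- product.
    have h5 : a ^ h.x * b ^ k.y = b ^ k.y * (c ^ (h.x * k.y) * a ^ h.x) := by
      rw [← h4]; group
    have cb (m n : ℤ) : Commute (c ^ m) (b ^ n) := hb.zpow_zpow m n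
    have ca (m n : ℤ) : Commute (c ^ m) (a ^ n) := ha.zpow_zpow m n
    have hz : c ^ (h.z + k.z + h.x * k.y) = c ^ (h.x * k.y) * c ^ h.z * c ^ k.z := by
      rw [← zpow_add, ← zpow_add]
      congr 1
      ring
    simp only [mul_x, mul_y, mul_z]
    calc b ^ (h.y + k.y) * a ^ (h.x + k.x) * c ^ (h.z + k.z + h.x * k.y)
        = b ^ h.y * b ^ k.y * a ^ h.x * a ^ k.x * (c ^ (h.x * k.y) * c ^ h.z * c ^ k.z) := by
          rw [hz, zpow_add b, zpow_add a]
          simp only [mul_assoc]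
      _ = b ^ h.y * b ^ k.y * a ^ h.x * (a ^ k.x * (c ^ (h.x * k.y) * c ^ h.z)) * c ^ k.z := by
          simp only [mul_assoc]
      _ = b ^ h.y * b ^ k.y * (a ^ h.x * c ^ (h.x * k.y)) * c ^ h.z * a ^ k.x * c ^ k.z := by
          rw [← ((ca _ k.x).mul_left (ca _ k.x)).eq]
          simp only [mul_assoc]
      _ = b ^ h.y * (b ^ k.y * (c ^ (h.x * k.y) * a ^ h.x)) * c ^ h.z * a ^ k.x * c ^ k.z := by
          rw [← (ca _ h.x).eq]
          simp only [mul_assoc]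
      _ = b ^ h.y * (a ^ h.x * (b ^ k.y * c ^ h.z)) * a ^ k.x * c ^ k.z := by
          rw [← h5]
          simp only [mul_assoc]
      _ = b ^ h.y * a ^ h.x * c ^ h.z * (b ^ k.y * a ^ k.x * c ^ k.z) := by
          rw [← (cb _ k.y).eq]
          simp only [mul_assoc]

theorem lift_apply {Q : Type*} [Group Q] (a b : Q) (ha : Commute ⁅a, b⁆ a)
    (hb : Commute ⁅a, b⁆ b) (h : Heisenberg) :
    lift a b ha hb h = b ^ h.y * a ^ h.x * ⁅a, b⁆ ^ h.z := rfl

theorem commutator_eq_one {h : Heisenberg} (hx : h.x = 0) (hy : h.y = 0) (k : Heisenberg) :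
    ⁅h, k⁆ = 1 := by
  ext <;> simp [commutatorElement_def, hx, hy]

end Heisenberg

-- Level stabilizers and the wreath recursion of the generators.

section Tree

theorem pairHom_mem_levelStab {n : ℕ} {g h : treeAut Bool} :
    pairHom (g, h) ∈ levelStab Bool (n + 1) ↔ g ∈ levelStab Bool n ∧ h ∈ levelStab Bool n := by
  constructor
  · intro H
    refine ⟨fun v hv => ?_, fun v hv => ?_⟩
    · have := H (false :: v) (by simp [hv])
      simpa [pairHom, pairFun] using this
    · have := H (true :: v) (by simp [hv])
      simpa [pairHom, pairFun] using this
  · rintro ⟨hg, hh⟩ (_ | ⟨_ | _, v⟩) hv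
    · simp at hv
    · simpa [pairHom, pairFun] using hg v (by simpa using hv)
    · simpa [pairHom, pairFun] using hh v (by simpa using hv)

theorem levelStab_antitone (X : Type) [Inhabited X] : Antitone (levelStab X) := by
  refine antitone_nat_of_succ_le fun n g hg v hv => ?_
  have h1 := hg (v ++ [default]) (by simp [hv])
  have h2 := ((g.2 v).2 (v ++ [default])).2 (by simp)
  rw [h1] at h2
  have h3 : v <+: v ++ [default] := by simp
  exact (List.prefix_of_prefix_length_le h2 h3 (g.2 v).1.le).eq_of_length (g.2 v).1

theorem rootSwap_mul_pairHom (g h : treeAut Bool) :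
    rootSwap * pairHom (g, h) = pairHom (h, g) * rootSwap := by
  apply Subtype.ext
  apply Equiv.ext
  rintro (_ | ⟨_ | _, v⟩) <;> rfl

theorem rootSwap_mul_self : rootSwap * rootSwap = 1 := by
  apply Subtype.ext
  apply Equiv.ext
  rintro (_ | ⟨_ | _, v⟩) <;> rfl

theorem basilicaB_conj (g h : treeAut Bool) :
    basilicaB * pairHom (g, h) * basilicaB⁻¹ =
      pairHom (h, basilicaA * g * basilicaA⁻¹) := by
  rw [mul_inv_eq_iff_eq_mul, basilicaB_eq, mul_assoc, rootSwap_mul_pairHom, ← mul_assoc,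
    ← mul_assoc, ← map_mul, ← map_mul]
  simp

theorem basilicaB_conj_inv (g h : treeAut Bool) :
    basilicaB⁻¹ * pairHom (g, h) * basilicaB =
      pairHom (basilicaA⁻¹ * h * basilicaA, g) := by
  have := basilicaB_conj (basilicaA⁻¹ * h * basilicaA) g
  have h2 : basilicaA * (basilicaA⁻¹ * h * basilicaA) * basilicaA⁻¹ = h := by group
  rw [h2] at this
  rw [← this]; group

theorem basilicaB_mul_self : basilicaB * basilicaB = pairHom (basilicaA, basilicaA) := by
  rw [basilicaB_eq, mul_assoc, ← mul_assoc rootSwap, rootSwap_mul_pairHom, mul_assoc (pairHom _),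
    rootSwap_mul_self, mul_one, ← map_mul]
  simp

theorem pairHom_mul_basilicaB_notMem (g h : treeAut Bool) :
    pairHom (g, h) * basilicaB ∉ levelStab Bool 1 := by
  intro H
  have h1 : pairHom (g, h) ∈ levelStab Bool 1 := pairHom_range ▸ ⟨_, rfl⟩
  have h2 : basilicaB ∈ levelStab Bool 1 := (Subgroup.mul_mem_cancel_left _ h1).1 H
  have h3 := h2 [true] rfl
  have h4 : basilicaB.1 [true] = [false] := rfl
  rw [h4] at h3
  simp at h3

theorem basilicaA_mem : basilicaA ∈ basilica := Subgroup.subset_closure (by simp)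
theorem basilicaB_mem : basilicaB ∈ basilica := Subgroup.subset_closure (by simp)

end Tree


-- The homomorphism to the Heisenberg group, built from its graph.

open Heisenberg

/-- The graph of the homomorphism from the Basilica group to the Heisenberg group. -/
def basilicaGraph : Subgroup (treeAut Bool × Heisenberg) :=
  Subgroup.closure {(basilicaA, α), (basilicaB, β)}

theorem basilicaA_mem_graph : (basilicaA, α) ∈ basilicaGraph := Subgroup.subset_closure (by simp)
theorem basilicaB_mem_graph : (basilicaB, β) ∈ basilicaGraph := Subgroup.subset_closure (by simp)

/-- The part of the graph over the stabilizer of level one, through the sections. -/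
def sectionGraph : Subgroup (treeAut Bool × Heisenberg) where
  carrier := {w | ∃ u ∈ basilicaGraph, ∃ v ∈ basilicaGraph, u.2.x = v.2.x ∧
    w = (pairHom (u.1, v.1), fold u.2 v.2)}
  one_mem' := ⟨1, one_mem _, 1, one_mem _, rfl, by
    rw [eq_comm, Prod.mk_eq_one]; exact ⟨map_one _, by ext <;> simp [fold]⟩⟩
  mul_mem' := by
    rintro _ _ ⟨u, hu, v, hv, e, rfl⟩ ⟨u', hu', v', hv', e', rfl⟩
    refine ⟨u * u', mul_mem hu hu', v * v', mul_mem hv hv', by simp [e, e'], ?_⟩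
    rw [Prod.mk_mul_mk, ← map_mul, ← fold_mul e]; rfl
  inv_mem' := by
    rintro _ ⟨u, hu, v, hv, e, rfl⟩
    refine ⟨u⁻¹, inv_mem hu, v⁻¹, inv_mem hv, by simp [e], ?_⟩
    rw [Prod.inv_mk, ← map_inv, ← fold_inv e]; rfl

theorem conj_mem_sectionGraph {w : treeAut Bool × Heisenberg} (hw : w ∈ sectionGraph) :
    (basilicaB, β) * w * (basilicaB, β)⁻¹ ∈ sectionGraph := by
  obtain ⟨u, hu, v, hv, e, rfl⟩ := hw
  refine ⟨v, hv, (basilicaA, α) * u * (basilicaA, α)⁻¹, mul_mem (mul_mem basilicaA_mem_graph hu)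
    (inv_mem basilicaA_mem_graph), by simp [e], ?_⟩
  simp only [Prod.mk_mul_mk, Prod.inv_mk, basilicaB_conj, ← fold_conj e]
  rfl

theorem conj_inv_mem_sectionGraph {w : treeAut Bool × Heisenberg} (hw : w ∈ sectionGraph) :
    (basilicaB, β)⁻¹ * w * (basilicaB, β) ∈ sectionGraph := by
  obtain ⟨u, hu, v, hv, e, rfl⟩ := hw
  refine ⟨(basilicaA, α)⁻¹ * v * (basilicaA, α), mul_mem (mul_mem (inv_mem basilicaA_mem_graph) hv)
    basilicaA_mem_graph, u, hu, by simp [e], ?_⟩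
  simp only [Prod.mk_mul_mk, Prod.inv_mk, basilicaB_conj_inv, ← fold_conj_inv e]
  rfl

theorem basilicaA_mem_sectionGraph : (basilicaA, α) ∈ sectionGraph := by
  refine ⟨1, one_mem _, _, basilicaB_mem_graph, rfl, ?_⟩
  rw [Prod.mk.injEq]
  exact ⟨basilicaA_eq, by ext <;> simp [fold, α, β]⟩

theorem basilicaB_sq_mem_sectionGraph : (basilicaB, β) * (basilicaB, β) ∈ sectionGraph := by
  refine ⟨_, basilicaA_mem_graph, _, basilicaA_mem_graph, rfl, ?_⟩
  rw [Prod.mk_mul_mk, Prod.mk.injEq]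
  exact ⟨basilicaB_mul_self, by ext <;> simp [fold, α, β]⟩

/-- The part over the stabilizer of level one contains `a` and `b²` and is normalized by `b`, so it
and its coset by `b` exhaust the graph. -/
theorem basilicaGraph_cases {w : treeAut Bool × Heisenberg} (hw : w ∈ basilicaGraph) :
    w ∈ sectionGraph ∨ ∃ s ∈ sectionGraph, w = s * (basilicaB, β) := by
  set B := (basilicaB, β) with hB
  induction hw using Subgroup.closure_induction_left with
  | one => exact Or.inl (one_mem _)
  | mul_left x hx y _ ih =>
    rcases hx with rfl | rfl
    · rcases ih with h | ⟨s, hs, rfl⟩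
      · exact Or.inl (mul_mem basilicaA_mem_sectionGraph h)
      · exact Or.inr ⟨_, mul_mem basilicaA_mem_sectionGraph hs, by rw [mul_assoc]⟩
    · rcases ih with h | ⟨s, hs, rfl⟩
      · exact Or.inr ⟨_, conj_mem_sectionGraph h, by rw [← hB]; group⟩
      · left
        have := mul_mem (conj_mem_sectionGraph hs) basilicaB_sq_mem_sectionGraph
        rw [← hB] at this ⊢
        convert this using 1
        group
  | inv_mul_cancel x hx y _ ih =>
    rcases hx with rfl | rfl
    · rcases ih with h | ⟨s, hs, rfl⟩
      · exact Or.inl (mul_mem (inv_mem basilicaA_mem_sectionGraph) h)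
      · exact Or.inr ⟨_, mul_mem (inv_mem basilicaA_mem_sectionGraph) hs, by rw [mul_assoc]⟩
    · rcases ih with h | ⟨s, hs, rfl⟩
      · refine Or.inr ⟨_, mul_mem (conj_inv_mem_sectionGraph h)
          (inv_mem basilicaB_sq_mem_sectionGraph), ?_⟩
        rw [← hB]; group
      · left
        rw [← hB, ← mul_assoc]
        exact conj_inv_mem_sectionGraph hs

/-- Elements of the graph over the stabilizer of level one come from their sections. -/
theorem mem_sectionGraph {w : treeAut Bool × Heisenberg} (hw : w ∈ basilicaGraph)
    (h1 : w.1 ∈ levelStab Bool 1) : w ∈ sectionGraph := by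
  rcases basilicaGraph_cases hw with h | ⟨s, ⟨u, _, v, _, _, rfl⟩, rfl⟩
  · exact h
  · exact absurd h1 (pairHom_mul_basilicaB_notMem _ _)

theorem even_y_of_mem_sectionGraph {w : treeAut Bool × Heisenberg} (hw : w ∈ sectionGraph) :
    2 ∣ w.2.y := by
  obtain ⟨u, _, v, _, _, rfl⟩ := hw
  exact ⟨_, rfl⟩

theorem mem_sectionGraph_of_even {w : treeAut Bool × Heisenberg} (hw : w ∈ basilicaGraph)
    (h : 2 ∣ w.2.y) : w ∈ sectionGraph := by
  rcases basilicaGraph_cases hw with h | ⟨s, hs, rfl⟩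
  · exact h
  · have := even_y_of_mem_sectionGraph hs
    have h2 : (s * (basilicaB, β)).2.y = s.2.y + 1 := rfl
    omega

theorem exists_sections {n : ℕ} {w : treeAut Bool × Heisenberg} (hw : w ∈ basilicaGraph)
    (h : w.1 ∈ levelStab Bool (n + 1)) :
    ∃ u ∈ basilicaGraph, ∃ v ∈ basilicaGraph, u.1 ∈ levelStab Bool n ∧ v.1 ∈ levelStab Bool n ∧
      u.2.x = v.2.x ∧ w.2 = fold u.2 v.2 := by
  obtain ⟨u, hu, v, hv, e, rfl⟩ :=
    mem_sectionGraph hw (levelStab_antitone Bool (Nat.le_add_left 1 n) h)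
  exact ⟨u, hu, v, hv, (pairHom_mem_levelStab.1 h).1, (pairHom_mem_levelStab.1 h).2, e, rfl⟩

/-- The coordinates of the elements of a level stabilizer are divisible by powers of two. -/
theorem dvd_of_mem_levelStab (k : ℕ) : ∀ w ∈ basilicaGraph, w.1 ∈ levelStab Bool (2 * k) →
    DvdCoords (2 ^ k) w.2 := by
  induction k with
  | zero => intro w _ _; simp [DvdCoords]
  | succ k ih =>
    -- One level does not gain a factor 2 in every coordinate: the new `x` is a sum of old `y`, the
    -- new `y` is twice the old `x`, and the new `z` involves the old `y` undoubled. After one level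
    -- only `y` has gained the factor, and the second level passes it to `x` and `z`.
    have step : ∀ w ∈ basilicaGraph, w.1 ∈ levelStab Bool (2 * k + 1) →
        (2 : ℤ) ^ k ∣ w.2.x ∧ (2 : ℤ) ^ (k + 1) ∣ w.2.y ∧ (2 : ℤ) ^ k ∣ w.2.z := by
      intro w hw h
      obtain ⟨u, hu, v, hv, hu', hv', e, hf⟩ := exists_sections hw h
      obtain ⟨⟨p, hp⟩, ⟨q, hq⟩, r, hr⟩ := ih u hu hu'
      obtain ⟨-, ⟨q', hq'⟩, r', hr'⟩ := ih v hv hv'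
      rw [hf]
      simp only [fold, hp, hq, hr, hq', hr']
      exact ⟨⟨q + q', by ring⟩, ⟨p, by ring⟩,
        ⟨2 * p * (2 ^ k * q + 2 ^ k * q') - q - 2 * (r + r'), by ring⟩⟩
    intro w hw h
    obtain ⟨u, hu, v, hv, hu', hv', e, hf⟩ := exists_sections (n := 2 * k + 1) hw h
    obtain ⟨⟨p, hp⟩, ⟨q, hq⟩, r, hr⟩ := step u hu hu'
    obtain ⟨-, ⟨q', hq'⟩, r', hr'⟩ := step v hv hv'
    rw [hf]
    simp only [fold, DvdCoords, hp, hq, hr, hq', hr']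
    exact ⟨⟨q + q', by ring⟩, ⟨p, by ring⟩,
      ⟨2 ^ k * 2 * p * (q + q') - q - (r + r'), by ring⟩⟩

/-- The identity lies in every level stabilizer. This is what makes the graph that of a function. -/
theorem eq_one_of_mem_graph {h : Heisenberg} (H : (1, h) ∈ basilicaGraph) : h = 1 :=
  eq_one_of_forall_dvd fun k => dvd_of_mem_levelStab k _ H (one_mem _)

theorem map_fst_basilicaGraph :
    basilicaGraph.map (MonoidHom.fst _ _) = basilica := by
  rw [basilicaGraph, MonoidHom.map_closure, Set.image_pair]
  rfl

theorem exists_unique_graph (g : basilica) : ∃! h, (g.1, h) ∈ basilicaGraph := by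
  have : g.1 ∈ basilicaGraph.map (MonoidHom.fst _ _) := by
    rw [map_fst_basilicaGraph]; exact g.2
  obtain ⟨⟨g', h⟩, hw, e⟩ := this
  change g' = g.1 at e
  subst e
  refine ⟨h, hw, fun k hk => ?_⟩
  have := mul_mem hk (inv_mem hw)
  rw [Prod.inv_mk, Prod.mk_mul_mk, mul_inv_cancel] at this
  exact mul_inv_eq_one.1 (eq_one_of_mem_graph this)

/-- The homomorphism from the Basilica group to the Heisenberg group. -/
noncomputable def toHeisenberg : basilica →* Heisenberg where
  toFun g := (exists_unique_graph g).choose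
  map_one' := ((exists_unique_graph 1).choose_spec.2 _ (one_mem basilicaGraph)).symm
  map_mul' g h := ((exists_unique_graph (g * h)).choose_spec.2 _
    (mul_mem (exists_unique_graph g).choose_spec.1 (exists_unique_graph h).choose_spec.1)).symm

theorem toHeisenberg_mem (g : basilica) : (g.1, toHeisenberg g) ∈ basilicaGraph :=
  (exists_unique_graph g).choose_spec.1

theorem toHeisenberg_eq {g : basilica} {h : Heisenberg} (H : (g.1, h) ∈ basilicaGraph) :
    toHeisenberg g = h :=
  ((exists_unique_graph g).choose_spec.2 _ H).symm

theorem mem_basilica_of_graph {w : treeAut Bool × Heisenberg} (hw : w ∈ basilicaGraph) :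
    w.1 ∈ basilica := by
  rw [← map_fst_basilicaGraph]; exact Subgroup.mem_map_of_mem (MonoidHom.fst _ _) hw

-- Commutators of the generators and normal forms in quotients.

section Generators

/-- The generator `a` as an element of the Basilica group. -/
def genA : basilica := ⟨basilicaA, basilicaA_mem⟩

/-- The generator `b` as an element of the Basilica group. -/
def genB : basilica := ⟨basilicaB, basilicaB_mem⟩

theorem toHeisenberg_genA : toHeisenberg genA = α := toHeisenberg_eq basilicaA_mem_graph
theorem toHeisenberg_genB : toHeisenberg genB = β := toHeisenberg_eq basilicaB_mem_graph

theorem basilica_hom_ext {Q : Type*} [Group Q] {f g : basilica →* Q} (hA : f genA = g genA)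
    (hB : f genB = g genB) : f = g := by
  refine MonoidHom.eq_of_eqOn_dense (Subgroup.closure_closure_coe_preimage
    (k := {basilicaA, basilicaB})) ?_
  rintro ⟨x, hx⟩ (h | h)
  · change x = _ at h
    subst h; exact hA
  · change x = _ at h
    subst h; exact hB

theorem pairHom_basilicaB_one : pairHom (basilicaB, 1) = basilicaB * basilicaA * basilicaB⁻¹ := by
  conv_rhs => rw [basilicaA_eq, basilicaB_conj]
  simp

theorem commutator_gen : ⁅basilicaA, basilicaB⁆ = pairHom (basilicaB⁻¹, basilicaB) := by
  have : ⁅basilicaA, basilicaB⁆ = basilicaA * (basilicaB * basilicaA * basilicaB⁻¹)⁻¹ := by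
    rw [commutatorElement_def]; group
  rw [this, ← pairHom_basilicaB_one, ← map_inv]
  conv_lhs => rw [basilicaA_eq]
  rw [← map_mul]
  simp

/-- `[a,b] = (b⁻¹, b)` and `a = (1, b)` commute in each section. Hence `[[a,b],b]` is the only
relator needed to make `[a,b]` central. -/
theorem commutator_gen_gen_left : ⁅⁅genA, genB⁆, genA⁆ = 1 := by
  apply Subtype.ext
  change ⁅⁅basilicaA, basilicaB⁆, basilicaA⁆ = 1
  rw [commutator_gen, basilicaA_eq, ← map_commutatorElement]
  have : ⁅((basilicaB⁻¹, basilicaB) : treeAut Bool × treeAut Bool),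
      ((1, basilicaB) : treeAut Bool × treeAut Bool)⁆ = 1 := by
    simp [commutatorElement_def]
  rw [this, map_one]

theorem commutator_gen_gen : ⁅⁅basilicaA, basilicaB⁆, basilicaB⁆ =
    pairHom (basilicaB⁻¹ * basilicaB⁻¹, basilicaB * basilicaA * basilicaB * basilicaA⁻¹) := by
  have : ⁅⁅basilicaA, basilicaB⁆, basilicaB⁆ =
      ⁅basilicaA, basilicaB⁆ * (basilicaB * ⁅basilicaA, basilicaB⁆ * basilicaB⁻¹)⁻¹ := by
    simp only [commutatorElement_def]; group
  rw [this, commutator_gen, basilicaB_conj, ← map_inv, ← map_mul]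
  simp [mul_assoc]

/-- Modulo a normal subgroup that contains `[[a, b], b]`, an element is determined by its Heisenberg
coordinates. -/
theorem mk_eq_of_commutator_mem (N : Subgroup basilica) [N.Normal]
    (hN : ⁅⁅genA, genB⁆, genB⁆ ∈ N) (g : basilica) : (g : basilica ⧸ N) =
    (genB : basilica ⧸ N) ^ (toHeisenberg g).y * (genA : basilica ⧸ N) ^ (toHeisenberg g).x *
      ⁅(genA : basilica ⧸ N), (genB : basilica ⧸ N)⁆ ^ (toHeisenberg g).z := by
  have ha : Commute ⁅(genA : basilica ⧸ N), (genB : basilica ⧸ N)⁆ genA := by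
    rw [← commutatorElement_eq_one_iff_commute]
    have := congrArg (QuotientGroup.mk' N) commutator_gen_gen_left
    rwa [map_commutatorElement, map_commutatorElement, map_one] at this
  have hb : Commute ⁅(genA : basilica ⧸ N), (genB : basilica ⧸ N)⁆ genB := by
    rw [← commutatorElement_eq_one_iff_commute]
    have := (QuotientGroup.eq_one_iff (N := N) _).2 hN
    rw [← QuotientGroup.mk'_apply] at this
    rwa [map_commutatorElement, map_commutatorElement] at this
  have : QuotientGroup.mk' N = (Heisenberg.lift _ _ ha hb).comp toHeisenberg := by
    apply basilica_hom_ext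
    · simp [toHeisenberg_genA, Heisenberg.lift_apply, α]
    · simp [toHeisenberg_genB, Heisenberg.lift_apply, β]
  exact DFunLike.congr_fun this g

/-- Says that the kernel is the least candidate: `[[a,b],b]` generates it as a normal subgroup, so
later inclusions of `γ₃` need checking on this one element. -/
theorem ker_toHeisenberg_le (N : Subgroup basilica) [N.Normal]
    (hN : ⁅⁅genA, genB⁆, genB⁆ ∈ N) : toHeisenberg.ker ≤ N := by
  intro g hg
  rw [← QuotientGroup.eq_one_iff, mk_eq_of_commutator_mem N hN, MonoidHom.mem_ker.1 hg]
  simp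

end Generators

-- Identification of `γ₃(G)` with the kernel.

/-- The first two Heisenberg coordinates. -/
def Heisenberg.proj : Heisenberg →* Multiplicative (ℤ × ℤ) where
  toFun h := Multiplicative.ofAdd (h.x, h.y)
  map_one' := rfl
  map_mul' _ _ := rfl

theorem lowerCentralSeries_two_le_ker :
    (⊤ : Subgroup basilica).lowerCentralSeries 2 ≤ toHeisenberg.ker := by
  rw [Subgroup.lowerCentralSeries_succ, Subgroup.commutator_le]
  intro g hg k _
  have h1 : (⊤ : Subgroup basilica).lowerCentralSeries 1 ≤
      (Heisenberg.proj.comp toHeisenberg).ker := by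
    rw [Subgroup.lowerCentralSeries_succ, Subgroup.commutator_le]
    intro g _ k _
    rw [MonoidHom.mem_ker, map_commutatorElement]
    exact commutatorElement_eq_one_iff_commute.2 (Commute.all _ _)
  have h2 : ((toHeisenberg g).x, (toHeisenberg g).y) = (0, 0) := h1 hg
  rw [Prod.mk.injEq] at h2
  rw [MonoidHom.mem_ker, map_commutatorElement]
  exact Heisenberg.commutator_eq_one h2.1 h2.2 _

theorem commutator_gen_mem_lowerCentralSeries :
    ⁅⁅genA, genB⁆, genB⁆ ∈ (⊤ : Subgroup basilica).lowerCentralSeries 2 :=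
  Subgroup.commutator_mem_commutator (Subgroup.commutator_mem_commutator trivial trivial) trivial

theorem lowerCentralSeries_two_eq_ker :
    (⊤ : Subgroup basilica).lowerCentralSeries 2 = toHeisenberg.ker :=
  le_antisymm lowerCentralSeries_two_le_ker
    (ker_toHeisenberg_le _ commutator_gen_mem_lowerCentralSeries)

theorem lowerCentralSeries_subgroupOf {G : Type*} [Group G] (H : Subgroup G) (n : ℕ) :
    (H.lowerCentralSeries n).subgroupOf H = (⊤ : Subgroup H).lowerCentralSeries n := by
  rw [← Subgroup.top_subtype_lowerCentralSeries, Subgroup.subgroupOf,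
    Subgroup.comap_map_eq_self_of_injective H.subtype_injective]

theorem gamma3_subgroupOf : basilicaGamma3.subgroupOf basilica = toHeisenberg.ker := by
  rw [basilicaGamma3, lowerCentralSeries_subgroupOf, lowerCentralSeries_two_eq_ker]

theorem gamma3_le : basilicaGamma3 ≤ basilica := Subgroup.lowerCentralSeries_le_self _ _

theorem mem_gamma3_iff {g : treeAut Bool} (hg : g ∈ basilica) :
    g ∈ basilicaGamma3 ↔ toHeisenberg ⟨g, hg⟩ = 1 := by
  rw [← MonoidHom.mem_ker, ← gamma3_subgroupOf, Subgroup.mem_subgroupOf]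

-- Finite `p`-group quotients.

section PowerOfTwoIndex

theorem isFinitePGroup_quotient_iff {p : ℕ} {G : Type} [Group G] (N : Subgroup G) [N.Normal] :
    IsFinitePGroup p (G ⧸ N) ↔ N.FiniteIndex ∧ ∀ g : G, ∃ k, g ^ p ^ k ∈ N := by
  rw [IsFinitePGroup, isPGroup_iff_pow_pow_eq_one]
  refine and_congr ⟨fun _ => Subgroup.finiteIndex_of_finite_quotient,
    fun _ => Subgroup.finite_quotient_of_finiteIndex⟩ ?_
  refine ⟨fun h g => ?_, fun h g => ?_⟩
  · obtain ⟨k, hk⟩ := h g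
    exact ⟨k, (QuotientGroup.eq_one_iff _).1 hk⟩
  · induction g using QuotientGroup.induction_on with
    | H g =>
      obtain ⟨k, hk⟩ := h g
      exact ⟨k, (QuotientGroup.eq_one_iff _).2 hk⟩

theorem IsFinitePGroup.comap {p : ℕ} {G H : Type} [Group G] [Group H] (f : G →* H)
    {N : Subgroup H} [N.Normal] (h : IsFinitePGroup p (H ⧸ N)) :
    IsFinitePGroup p (G ⧸ N.comap f) := by
  rw [isFinitePGroup_quotient_iff] at h ⊢
  have := h.1
  refine ⟨⟨?_⟩, fun g => ?_⟩
  · rw [Subgroup.index_comap]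
    exact ne_zero_of_dvd_ne_zero this.index_ne_zero (N.relIndex_dvd_index_of_normal _)
  obtain ⟨k, hk⟩ := h.2 (f g)
  exact ⟨k, by rwa [Subgroup.mem_comap, map_pow]⟩

theorem IsFinitePGroup.inf {p : ℕ} {G : Type} [Group G] {N M : Subgroup G} [N.Normal] [M.Normal]
    (hN : IsFinitePGroup p (G ⧸ N)) (hM : IsFinitePGroup p (G ⧸ M)) :
    IsFinitePGroup p (G ⧸ N ⊓ M) := by
  rw [isFinitePGroup_quotient_iff] at *
  have := hN.1
  have := hM.1
  refine ⟨inferInstance, fun g => ?_⟩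
  obtain ⟨k, hk⟩ := hN.2 g
  obtain ⟨l, hl⟩ := hM.2 g
  refine ⟨k + l, ?_, ?_⟩
  · rw [pow_add, pow_mul]; exact pow_mem hk _
  · rw [add_comm, pow_add, pow_mul]; exact pow_mem hl _

theorem IsFinitePGroup.of_le {p : ℕ} {G : Type} [Group G] {N M : Subgroup G} [N.Normal] [M.Normal]
    (hN : IsFinitePGroup p (G ⧸ N)) (h : N ≤ M) : IsFinitePGroup p (G ⧸ M) := by
  rw [isFinitePGroup_quotient_iff] at *
  have := hN.1
  refine ⟨Subgroup.finiteIndex_of_le h, fun g => ?_⟩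
  obtain ⟨k, hk⟩ := hN.2 g
  exact ⟨k, h hk⟩

theorem IsFinitePGroup.exists_pow_eq_one {Q : Type} [Group Q] (h : IsFinitePGroup 2 Q) :
    ∃ k : ℕ, ∀ q : Q, ∀ m : ℤ, 2 ^ k ∣ m → q ^ m = 1 := by
  have := h.1
  obtain ⟨k, hk⟩ := IsPGroup.iff_card.1 h.2
  refine ⟨k, fun q m hm => ?_⟩
  obtain ⟨l, rfl⟩ := hm
  have h1 : q ^ 2 ^ k = 1 := hk ▸ pow_card_eq_one'
  rw [zpow_mul]
  have h2 : q ^ ((2 : ℤ) ^ k) = q ^ 2 ^ k := by rw [← zpow_natCast]; simp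
  rw [h2, h1, one_zpow]

end PowerOfTwoIndex

-- Level quotients of the binary tree are finite 2-groups.

section LevelStab

instance levelStab_normal (X : Type) (n : ℕ) : (levelStab X n).Normal := by
  refine ⟨fun h hh g v hv => ?_⟩
  have h1 : h.1 ((g⁻¹).1 v) = (g⁻¹).1 v := hh _ (((g⁻¹).2 v).1.trans hv)
  change g.1 (h.1 ((g⁻¹).1 v)) = v
  rw [h1]
  exact g.1.apply_symm_apply v

/-- The action of the automorphism group on a level. -/
def levelHom (X : Type) (n : ℕ) : treeAut X →* Equiv.Perm {v : List X // v.length = n} where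
  toFun g := g.1.subtypePerm fun v => by rw [(g.2 v).1]
  map_one' := rfl
  map_mul' _ _ := rfl

theorem ker_levelHom (X : Type) (n : ℕ) : (levelHom X n).ker = levelStab X n := by
  ext g
  rw [MonoidHom.mem_ker, Equiv.ext_iff]
  exact ⟨fun h v hv => congrArg Subtype.val (h ⟨v, hv⟩), fun h v => Subtype.ext (h v.1 v.2)⟩

instance levelStab_finiteIndex (X : Type) [Finite X] (n : ℕ) : (levelStab X n).FiniteIndex := by
  have : Finite {v : List X // v.length = n} := List.finite_length_eq X n
  rw [← ker_levelHom]
  infer_instance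

theorem mul_self_mem_levelStab_one (g : treeAut Bool) : g * g ∈ levelStab Bool 1 := by
  have key : ∀ x, ∃ y, g.1 [x] = [y] := fun x => List.length_eq_one_iff.1 (g.2 [x]).1
  obtain ⟨s, hs⟩ := key false
  obtain ⟨t, ht⟩ := key true
  have hst : s ≠ t := by
    rintro rfl
    simpa using g.1.injective (hs.trans ht.symm)
  intro v hv
  obtain ⟨x, rfl⟩ := List.length_eq_one_iff.1 hv
  change g.1 (g.1 [x]) = [x]
  cases x <;> cases s <;> cases t <;> simp_all

/-- A square fixes level one, and induction applies to its two sections. -/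
theorem pow_mem_levelStab (n : ℕ) : ∀ g : treeAut Bool, g ^ 2 ^ n ∈ levelStab Bool n := by
  induction n with
  | zero =>
    intro g v hv
    rw [List.length_eq_zero_iff] at hv
    subst hv
    exact List.length_eq_zero_iff.1 ((g ^ 2 ^ 0).2 []).1
  | succ n ih =>
    intro g
    have h := mul_self_mem_levelStab_one g
    rw [← pairHom_range] at h
    obtain ⟨⟨x, y⟩, hxy⟩ := h
    rw [pow_succ', pow_mul, sq, ← hxy, ← map_pow, Prod.pow_mk, pairHom_mem_levelStab]
    exact ⟨ih x, ih y⟩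

instance levelStabIn_normal {X : Type} (G : Subgroup (treeAut X)) (n : ℕ) :
    (levelStabIn G n).Normal := by
  unfold levelStabIn; infer_instance

theorem levelStabIn_isFinitePGroup (G : Subgroup (treeAut Bool)) (n : ℕ) :
    IsFinitePGroup 2 (G ⧸ levelStabIn G n) := by
  rw [isFinitePGroup_quotient_iff]
  exact ⟨by unfold levelStabIn; infer_instance, fun g => ⟨n, pow_mem_levelStab n g.1⟩⟩

end LevelStab

-- The 2-CSP modulo `γ₃(G)`, failure of the CSP, and the abelianization.

theorem dvd_toHeisenberg {k : ℕ} {g : basilica} (hg : g.1 ∈ levelStab Bool (2 * k)) :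
    DvdCoords (2 ^ k) (toHeisenberg g) :=
  dvd_of_mem_levelStab k _ (toHeisenberg_mem g) hg

/-- In a quotient of exponent dividing `2^k`, the normal form `b^y a^x [a,b]^z` of an element of
`st(2k)` is trivial. -/
theorem basilica_classCSPMod_gamma3 : HasClassCSPMod (IsFinitePGroup 2) basilica basilicaGamma3 := by
  refine ⟨gamma3_le, ?_, fun N _ hC hN => ?_⟩
  · rw [gamma3_subgroupOf]; infer_instance
  obtain ⟨k, hk⟩ := hC.exists_pow_eq_one
  refine ⟨2 * k, fun g hg => ?_⟩
  obtain ⟨hx, hy, hz⟩ := dvd_toHeisenberg hg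
  rw [gamma3_subgroupOf, ← lowerCentralSeries_two_eq_ker] at hN
  rw [← QuotientGroup.eq_one_iff,
    mk_eq_of_commutator_mem N (hN commutator_gen_mem_lowerCentralSeries), hk _ _ hx, hk _ _ hy,
    hk _ _ hz]
  simp

theorem basilica_not_hasCSP : ¬ HasCSP basilica := by
  intro H
  let f : Multiplicative (ℤ × ℤ) →* Multiplicative (ZMod 3) :=
    AddMonoidHom.toMultiplicative ((Int.castAddHom (ZMod 3)).comp (AddMonoidHom.fst ℤ ℤ))
  -- The exponent of `a` modulo 3. Since `a^(2^n)` lies in `st(n)`, a congruence kernel would force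
  -- 3 to divide `2^n`.
  let φ := f.comp (Heisenberg.proj.comp toHeisenberg)
  obtain ⟨n, hn⟩ := H φ.ker inferInstance
  have h1 : φ (genA ^ 2 ^ n) = 1 := hn (pow_mem_levelStab n basilicaA)
  have h2 : φ genA = Multiplicative.ofAdd 1 := by
    simp [φ, toHeisenberg_genA, Heisenberg.proj, f, α]
  rw [map_pow, h2, ← ofAdd_nsmul, ofAdd_eq_one, nsmul_one, ZMod.natCast_eq_zero_iff] at h1
  have := Nat.prime_three.dvd_of_dvd_pow h1
  omega

/-- The powers of `a` and `b` in the abelianization. -/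
def abelianizationInv : Multiplicative (ℤ × ℤ) →* Abelianization basilica where
  toFun p := Abelianization.of genA ^ p.toAdd.1 * Abelianization.of genB ^ p.toAdd.2
  map_one' := by simp
  map_mul' p q := by
    simp only [toAdd_mul, Prod.fst_add, Prod.snd_add, zpow_add]
    exact mul_mul_mul_comm _ _ _ _

theorem abelianization_basilica :
    Nonempty (Abelianization basilica ≃* Multiplicative (ℤ × ℤ)) := by
  refine ⟨MonoidHom.toMulEquiv (Abelianization.lift (Heisenberg.proj.comp toHeisenberg))
    abelianizationInv ?_ ?_⟩
  · apply Abelianization.hom_ext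
    apply basilica_hom_ext
    · simp [abelianizationInv, toHeisenberg_genA, Heisenberg.proj, α]
    · simp [abelianizationInv, toHeisenberg_genB, Heisenberg.proj, β]
  · ext p
    all_goals simp [abelianizationInv, toHeisenberg_genA, toHeisenberg_genB, Heisenberg.proj, α, β]

-- `γ_n × γ_n ≤ γ_{n+1}` for `n ≥ 3`.

/-- The three subgroups lemma, applied modulo `γ₄`. -/
theorem commutator_commutator_le_lowerCentralSeries (G : Type*) [Group G] :
    ⁅(⊤ : Subgroup G).lowerCentralSeries 1, (⊤ : Subgroup G).lowerCentralSeries 1⁆ ≤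
      (⊤ : Subgroup G).lowerCentralSeries 3 := by
  set N := (⊤ : Subgroup G).lowerCentralSeries 3 with hN
  have key : ∀ n, ((⊤ : Subgroup G).lowerCentralSeries n).map (QuotientGroup.mk' N) =
      (⊤ : Subgroup (G ⧸ N)).lowerCentralSeries n := fun n => by
    rw [Subgroup.map_lowerCentralSeries, Subgroup.map_top_of_surjective _
      (QuotientGroup.mk'_surjective N)]
  let T : Subgroup (G ⧸ N) := ⊤
  have h3 : ⁅⁅⁅T, T⁆, T⁆, T⁆ = ⊥ := by
    rw [eq_bot_iff]
    change T.lowerCentralSeries 3 ≤ ⊥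
    rw [← key, Subgroup.map_le_iff_le_comap, MonoidHom.comap_bot, QuotientGroup.ker_mk']
  have h4 : ⁅⁅T, T⁆, ⁅T, T⁆⁆ = ⊥ :=
    Subgroup.commutator_commutator_eq_bot_of_rotate
      (by rwa [Subgroup.commutator_comm T ⁅_, _⁆]) h3
  rw [← QuotientGroup.ker_mk' N, ← MonoidHom.comap_bot, ← Subgroup.map_le_iff_le_comap,
    Subgroup.map_commutator, key]
  exact h4.le

/-- The embedding `g ↦ (g, 1)`. -/
def pairLeft : treeAut Bool →* treeAut Bool := pairHom.comp (MonoidHom.inl _ _)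

theorem pairLeft_apply (g : treeAut Bool) : pairLeft g = pairHom (g, 1) := rfl

/-- Conjugation by `b` moves the first section to the second, so only elements `(g, 1)` need study.
-/
theorem pairHom_eq_mul (g h : treeAut Bool) : pairHom (g, h) =
    pairLeft g * (basilicaB * pairLeft (basilicaA⁻¹ * h * basilicaA) * basilicaB⁻¹) := by
  rw [pairLeft_apply, pairLeft_apply, basilicaB_conj, ← map_mul]
  congr 1
  simp [mul_assoc]

/-- `b² = (a, a)` and `b a b⁻¹ = (b, 1)` supply the generators. Conjugation by any `g` in `G` can
thus be carried out on the first section from within `G`. -/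
theorem exists_pairHom_mem_basilica {g : treeAut Bool} (hg : g ∈ basilica) :
    ∃ h, pairHom (g, h) ∈ basilica := by
  have : basilica ≤ (basilica.comap pairHom).map (MonoidHom.fst _ _) := by
    nth_rw 1 [basilica]
    rw [Subgroup.closure_le]
    rintro _ (rfl | rfl)
    · refine ⟨(basilicaA, basilicaA), ?_, rfl⟩
      change pairHom _ ∈ basilica
      rw [← basilicaB_mul_self]
      exact mul_mem basilicaB_mem basilicaB_mem
    · refine ⟨(basilicaB, 1), ?_, rfl⟩
      change pairHom _ ∈ basilica
      rw [pairHom_basilicaB_one]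
      exact mul_mem (mul_mem basilicaB_mem basilicaA_mem) (inv_mem basilicaB_mem)
  obtain ⟨⟨x, y⟩, h1, rfl⟩ := this hg
  exact ⟨y, h1⟩

theorem pairHom_conj (g h x y : treeAut Bool) :
    pairHom (g, h) * pairHom (x, y) * (pairHom (g, h))⁻¹ =
      pairHom (g * x * g⁻¹, h * y * h⁻¹) := by
  rw [← map_inv, ← map_mul, ← map_mul]; rfl

theorem pairLeft_conj (g h x : treeAut Bool) :
    pairHom (g, h) * pairLeft x * (pairHom (g, h))⁻¹ = pairLeft (g * x * g⁻¹) := by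
  simp only [pairLeft_apply, pairHom_conj, mul_one, mul_inv_cancel]

theorem pairLeft_commutator (x g h : treeAut Bool) :
    ⁅pairLeft x, pairHom (g, h)⁆ = pairLeft ⁅x, g⁆ := by
  rw [pairLeft_apply, pairLeft_apply, ← map_commutatorElement]
  congr 1
  ext1 <;> simp [commutatorElement_def]

theorem conj_mem_lowerCentralSeries {n : ℕ} {g x : treeAut Bool} (hg : g ∈ basilica)
    (hx : x ∈ basilica.lowerCentralSeries n) : g * x * g⁻¹ ∈ basilica.lowerCentralSeries n :=
  (Subgroup.mem_normalizer_iff.1 (basilica.self_le_normalizer_lowerCentralSeries n hg) x).1 hx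

/-- The element equals `[[b², bab⁻¹], [a,b]⁻¹]`, because `b² = (a, a)`, `bab⁻¹ = (b, 1)` and
`[a,b]⁻¹ = (b, b⁻¹)`; this is a commutator of two elements of `G'`. -/
theorem pairLeft_commutator_mem :
    pairLeft ⁅⁅basilicaA, basilicaB⁆, basilicaB⁆ ∈ basilica.lowerCentralSeries 3 := by
  have h1 : pairLeft ⁅basilicaA, basilicaB⁆ = ⁅basilicaB * basilicaB,
      basilicaB * basilicaA * basilicaB⁻¹⁆ := by
    rw [basilicaB_mul_self, ← pairHom_basilicaB_one, ← map_commutatorElement, pairLeft_apply]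
    congr 1
    ext1 <;> simp [commutatorElement_def]
  have h2 : pairHom (basilicaB, basilicaB⁻¹) = ⁅basilicaA, basilicaB⁆⁻¹ := by
    rw [commutator_gen, ← map_inv]; simp
  rw [← pairLeft_commutator _ _ (basilicaB⁻¹), h1, h2]
  rw [← Subgroup.top_subtype_lowerCentralSeries]
  refine ⟨⁅⁅genB * genB, genB * genA * genB⁻¹⁆, ⁅genA, genB⁆⁻¹⁆, ?_, rfl⟩
  apply commutator_commutator_le_lowerCentralSeries
  exact Subgroup.commutator_mem_commutator
    (Subgroup.commutator_mem_commutator trivial trivial)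
    (inv_mem (Subgroup.commutator_mem_commutator trivial trivial))

theorem gamma3_le_comap_pairLeft :
    basilicaGamma3 ≤ (basilica.lowerCentralSeries 3).comap pairLeft := by
  let X := ((basilica.lowerCentralSeries 3).comap pairLeft).subgroupOf basilica
  have : X.Normal := ⟨fun x hx g => by
    obtain ⟨t, ht⟩ := exists_pairHom_mem_basilica g.2
    change pairLeft (g.1 * x.1 * g.1⁻¹) ∈ basilica.lowerCentralSeries 3
    rw [← pairLeft_conj _ t]
    exact conj_mem_lowerCentralSeries ht hx⟩
  have h : toHeisenberg.ker ≤ X := ker_toHeisenberg_le X pairLeft_commutator_mem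
  intro g hg
  exact h (show (⟨g, gamma3_le hg⟩ : basilica) ∈ _ from (mem_gamma3_iff _).1 hg)

theorem lowerCentralSeries_le_comap_pairLeft (n : ℕ) : basilica.lowerCentralSeries (n + 2) ≤
    (basilica.lowerCentralSeries (n + 3)).comap pairLeft := by
  induction n with
  | zero => exact gamma3_le_comap_pairLeft
  | succ n ih =>
    rw [Subgroup.lowerCentralSeries_succ, Subgroup.commutator_le]
    intro x hx g hg
    obtain ⟨t, ht⟩ := exists_pairHom_mem_basilica hg
    rw [Subgroup.mem_comap, ← pairLeft_commutator _ _ t]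
    exact Subgroup.commutator_mem_commutator (ih hx) ht

theorem map_pairHom_lowerCentralSeries_le (n : ℕ) :
    ((basilica.lowerCentralSeries (n + 2)).prod (basilica.lowerCentralSeries (n + 2))).map pairHom ≤
      basilica.lowerCentralSeries (n + 3) := by
  rintro _ ⟨⟨g, h⟩, ⟨hg, hh⟩, rfl⟩
  rw [pairHom_eq_mul]
  refine mul_mem (lowerCentralSeries_le_comap_pairLeft n hg)
    (conj_mem_lowerCentralSeries basilicaB_mem (lowerCentralSeries_le_comap_pairLeft n ?_))
  have := conj_mem_lowerCentralSeries (inv_mem basilicaA_mem) hh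
  rwa [inv_inv] at this

-- The chain of iterated powers of `γ₃(G)`.

/-- The group of all automorphisms that fix level `m` and whose sections there lie in `γ₃(G)`. -/
def gamma3Power : ℕ → Subgroup (treeAut Bool)
  | 0 => basilicaGamma3
  | m + 1 => ((gamma3Power m).prod (gamma3Power m)).map pairHom

theorem gamma3Power_le_lowerCentralSeries (m : ℕ) :
    gamma3Power m ≤ basilica.lowerCentralSeries (m + 2) := by
  induction m with
  | zero => exact le_rfl
  | succ m ih =>
    exact (Subgroup.map_mono (Subgroup.prod_mono ih ih)).trans (map_pairHom_lowerCentralSeries_le m)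

theorem gamma3Power_le (m : ℕ) : gamma3Power m ≤ basilica :=
  (gamma3Power_le_lowerCentralSeries m).trans (Subgroup.lowerCentralSeries_le_self _ _)

theorem gamma3Power_succ_le (m : ℕ) : gamma3Power (m + 1) ≤ gamma3Power m := by
  induction m with
  | zero =>
    exact (gamma3Power_le_lowerCentralSeries 1).trans
      (Subgroup.lowerCentralSeries_antitone _ (by norm_num))
  | succ m ih => exact Subgroup.map_mono (Subgroup.prod_mono ih ih)

/-- The sections of an element of the Basilica group that fixes level one. -/
theorem exists_pairHom_eq {g : basilica} (hg : 2 ∣ (toHeisenberg g).y) :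
    ∃ u v : basilica, g.1 = pairHom (u.1, v.1) ∧ (toHeisenberg u).x = (toHeisenberg v).x ∧
      toHeisenberg g = fold (toHeisenberg u) (toHeisenberg v) := by
  obtain ⟨u, hu, v, hv, e, h⟩ := mem_sectionGraph_of_even (toHeisenberg_mem g) hg
  rw [Prod.mk.injEq] at h
  refine ⟨⟨u.1, mem_basilica_of_graph hu⟩, ⟨v.1, mem_basilica_of_graph hv⟩, h.1, ?_, ?_⟩
  · rwa [toHeisenberg_eq (g := ⟨u.1, _⟩) hu, toHeisenberg_eq (g := ⟨v.1, _⟩) hv]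
  · rw [toHeisenberg_eq (g := ⟨u.1, _⟩) hu, toHeisenberg_eq (g := ⟨v.1, _⟩) hv]; exact h.2

theorem gamma3Power_conj (m : ℕ) : ∀ g ∈ basilica, ∀ x ∈ gamma3Power m,
    g * x * g⁻¹ ∈ gamma3Power m := by
  induction m with
  | zero => exact fun g hg x hx => conj_mem_lowerCentralSeries hg hx
  | succ m ih =>
    intro g hg
    have key : ∀ {u v : treeAut Bool}, u ∈ basilica → v ∈ basilica → ∀ x ∈ gamma3Power (m + 1),
        pairHom (u, v) * x * (pairHom (u, v))⁻¹ ∈ gamma3Power (m + 1) := by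
      rintro u v hu hv _ ⟨⟨x, y⟩, ⟨hx, hy⟩, rfl⟩
      rw [pairHom_conj]
      exact ⟨_, ⟨ih _ hu _ hx, ih _ hv _ hy⟩, rfl⟩
    by_cases h : 2 ∣ (toHeisenberg ⟨g, hg⟩).y
    · obtain ⟨u, v, e, -⟩ := exists_pairHom_eq h
      change g = _ at e
      rw [e]
      exact key u.2 v.2
    -- Outside the stabilizer of level one, `g b` lies inside it, and conjugation by `b⁻¹` preserves
    -- the power.
    · have h2 : 2 ∣ (toHeisenberg (⟨g, hg⟩ * genB)).y := by
        rw [map_mul, toHeisenberg_genB, Heisenberg.mul_y]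
        change 2 ∣ _ + 1
        omega
      obtain ⟨u, v, e, -⟩ := exists_pairHom_eq h2
      change g * basilicaB = _ at e
      rw [eq_mul_inv_of_mul_eq e]
      rintro _ ⟨⟨x, y⟩, ⟨hx, hy⟩, rfl⟩
      have h3 : basilicaB⁻¹ * pairHom (x, y) * basilicaB ∈ gamma3Power (m + 1) := by
        rw [basilicaB_conj_inv]
        refine ⟨_, ⟨?_, hx⟩, rfl⟩
        have := ih _ (inv_mem basilicaA_mem) _ hy
        rwa [inv_inv] at this
      have := key u.2 v.2 _ h3
      convert this using 1
      group

instance gamma3Power_subgroupOf_normal (m : ℕ) : ((gamma3Power m).subgroupOf basilica).Normal :=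
  ⟨fun x hx g => gamma3Power_conj m g.1 g.2 x.1 hx⟩

theorem gamma3Power_succ_subgroupOf_normal (m : ℕ) :
    ((gamma3Power (m + 1)).subgroupOf (gamma3Power m)).Normal :=
  ⟨fun x hx g => gamma3Power_conj (m + 1) g.1 (gamma3Power_le m g.2) x.1 hx⟩

-- The 2-CSP of `γ₃(G)` modulo `γ₃(G) × γ₃(G)`.

/-- The abelian subgroup of the Heisenberg group where the first coordinate vanishes. -/
def Heisenberg.incl : Multiplicative (ℤ × ℤ) →* Heisenberg where
  toFun p := ⟨0, p.toAdd.1, p.toAdd.2⟩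
  map_one' := rfl
  map_mul' p q := by ext <;> simp

theorem Heisenberg.mk_zero_zpow (y z n : ℤ) :
    (⟨0, y, z⟩ : Heisenberg) ^ n = ⟨0, n * y, n * z⟩ := by
  have := map_zpow Heisenberg.incl (Multiplicative.ofAdd (y, z)) n
  rw [← ofAdd_zsmul] at this
  exact this.symm.trans (by simp [incl])

/-- The first section of `[[a, b], b]`. -/
def commLeft : basilica := genB⁻¹ * genB⁻¹

/-- The second section of `[[a, b], b]`. -/
def commRight : basilica := genB * genA * genB * genA⁻¹

theorem toHeisenberg_commLeft : toHeisenberg commLeft = ⟨0, -2, 0⟩ := by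
  simp only [commLeft, map_mul, map_inv, toHeisenberg_genB]
  ext <;> simp [β]

theorem toHeisenberg_commRight : toHeisenberg commRight = ⟨0, 2, 1⟩ := by
  simp only [commRight, map_mul, map_inv, toHeisenberg_genB, toHeisenberg_genA]
  ext <;> simp [α, β]

theorem pairHom_comm_mem : pairHom (commLeft.1, commRight.1) ∈ basilicaGamma3 := by
  have h : pairHom (commLeft.1, commRight.1) = ⁅⁅basilicaA, basilicaB⁆, basilicaB⁆ :=
    commutator_gen_gen.symm
  rw [h]
  exact Subgroup.commutator_mem_commutator
    (Subgroup.commutator_mem_commutator basilicaA_mem basilicaB_mem) basilicaB_mem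

theorem pairHom_comm_mul_conj_mem : pairHom ((commLeft * commRight).1,
    (commRight * (genA * commLeft * genA⁻¹)).1) ∈ basilicaGamma3 := by
  have h := conj_mem_lowerCentralSeries basilicaB_mem pairHom_comm_mem
  rw [basilicaB_conj] at h
  have := mul_mem pairHom_comm_mem h
  rwa [← map_mul] at this

theorem gamma3_classCSPMod :
    HasClassCSPMod (IsFinitePGroup 2) basilicaGamma3 basilicaGamma3Square := by
  refine ⟨gamma3Power_succ_le 0, gamma3Power_succ_subgroupOf_normal 0, fun N _ hC hN => ?_⟩
  obtain ⟨k, hk⟩ := hC.exists_pow_eq_one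
  -- One extra level, so that both sections lie in `st(2k)`.
  refine ⟨2 * k + 1, fun g hg => ?_⟩
  have hg1 := (mem_gamma3_iff (gamma3_le g.2)).1 g.2
  obtain ⟨u, v, e, hx, hf⟩ := exists_pairHom_eq (g := ⟨g.1, gamma3_le g.2⟩) (by rw [hg1]; simp)
  rw [hg1] at hf
  change g.1 = _ at e
  have hst : g.1 ∈ levelStab Bool (2 * k + 1) := hg
  rw [e, pairHom_mem_levelStab] at hst
  obtain ⟨-, -, hu⟩ := dvd_toHeisenberg hst.1
  obtain ⟨-, -, hv⟩ := dvd_toHeisenberg hst.2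
  obtain ⟨f1, f2, f3⟩ := Heisenberg.ext_iff.1 hf
  simp only [fold, one_x, one_y, one_z] at f1 f2 f3
  have hux : (toHeisenberg u).x = 0 := by omega
  have hvx : (toHeisenberg v).x = 0 := by omega
  rw [hux] at f3
  -- The equation `fold = 1` leaves two free parameters: the sections have coordinates `(0, -2s, m)`
  -- and `(0, 2s, s - m)`. Those of `d` are `(0, -2, 0)`, `(0, 2, 1)` and those of `c` are `(0, 0,
  -- 1)`, `(0, 0, -1)`, so `g` agrees with `d^s c^m` modulo `γ₃ × γ₃`, and `2^k` divides both
  -- exponents.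
  set m := (toHeisenberg u).z with hm
  set s := (toHeisenberg u).z + (toHeisenberg v).z with hs
  let d : basilicaGamma3 := ⟨_, pairHom_comm_mem⟩
  let c : basilicaGamma3 := ⟨_, pairHom_comm_mul_conj_mem⟩
  have hd : d ^ s ∈ N := by
    rw [← QuotientGroup.eq_one_iff, QuotientGroup.mk_zpow]
    exact hk _ _ (dvd_add hu hv)
  have hc : c ^ m ∈ N := by
    rw [← QuotientGroup.eq_one_iff, QuotientGroup.mk_zpow]
    exact hk _ _ hu
  have hr : g * (d ^ s * c ^ m)⁻¹ ∈ N := by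
    apply hN
    let u' : basilica := u * (commLeft ^ s * (commLeft * commRight) ^ m)⁻¹
    let v' : basilica := v * (commRight ^ s * (commRight * (genA * commLeft * genA⁻¹)) ^ m)⁻¹
    have h1 : (g * (d ^ s * c ^ m)⁻¹).1 = pairHom (u'.1, v'.1) := by
      change g.1 * (pairHom _ ^ s * pairHom _ ^ m)⁻¹ = _
      rw [e, ← map_zpow, ← map_zpow, ← map_mul, ← map_inv, ← map_mul]
      rfl
    rw [Subgroup.mem_subgroupOf, h1]
    refine ⟨_, ⟨(mem_gamma3_iff u'.2).2 ?_, (mem_gamma3_iff v'.2).2 ?_⟩, rfl⟩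
    · change toHeisenberg u' = 1
      have h2 : toHeisenberg (commLeft * commRight) = ⟨0, 0, 1⟩ := by
        rw [map_mul, toHeisenberg_commLeft, toHeisenberg_commRight]
        ext <;> simp
      rw [map_mul, map_inv, map_mul, map_zpow, map_zpow, h2, toHeisenberg_commLeft,
        mk_zero_zpow, mk_zero_zpow, mul_inv_eq_one]
      ext <;> simp <;> omega
    · change toHeisenberg v' = 1
      have h2 : toHeisenberg (commRight * (genA * commLeft * genA⁻¹)) = ⟨0, 0, -1⟩ := by
        simp only [map_mul, map_inv, toHeisenberg_commLeft, toHeisenberg_commRight,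
          toHeisenberg_genA]
        ext <;> simp [α]
      rw [map_mul, map_inv, map_mul, map_zpow, map_zpow, h2, toHeisenberg_commRight,
        mk_zero_zpow, mk_zero_zpow, mul_inv_eq_one]
      ext <;> simp <;> omega
  have := mul_mem hr (mul_mem hd hc)
  rwa [inv_mul_cancel_right] at this

-- From the successive factors of the chain to the 2-CSP of `G`.

theorem pairHom_mem_gamma3Power {m : ℕ} {x y : treeAut Bool} (hx : x ∈ gamma3Power m)
    (hy : y ∈ gamma3Power m) : pairHom (x, y) ∈ gamma3Power (m + 1) := ⟨_, ⟨hx, hy⟩, rfl⟩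

/-- The isomorphism of `K × K` with its image under `pairHom`, for the groups `gamma3Power`. -/
def gamma3PowerPair (m : ℕ) : gamma3Power m × gamma3Power m →* gamma3Power (m + 1) where
  toFun p := ⟨pairHom (p.1.1, p.2.1), pairHom_mem_gamma3Power p.1.2 p.2.2⟩
  map_one' := Subtype.ext (map_one pairHom)
  map_mul' p q := Subtype.ext (map_mul pairHom (p.1.1, p.2.1) (q.1.1, q.2.1))

theorem gamma3Power_classCSP (m : ℕ) : ∀ (N : Subgroup (gamma3Power m)) [N.Normal],
    IsFinitePGroup 2 (gamma3Power m ⧸ N) → (gamma3Power (m + 1)).subgroupOf (gamma3Power m) ≤ N →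
      ∃ n, levelStabIn (gamma3Power m) n ≤ N := by
  induction m with
  | zero => exact gamma3_classCSPMod.2.2
  | succ m ih =>
    intro N _ hC hN
    -- The two direct factors are treated separately; the extra level below accounts for passing to
    -- sections.
    let f := (gamma3PowerPair m).comp (MonoidHom.inl _ _)
    let g := (gamma3PowerPair m).comp (MonoidHom.inr _ _)
    obtain ⟨k, hk⟩ := ih (N.comap f) (hC.comap f) fun x hx =>
      hN (show pairHom (x.1, 1) ∈ gamma3Power (m + 2) from pairHom_mem_gamma3Power hx (one_mem _))
    obtain ⟨l, hl⟩ := ih (N.comap g) (hC.comap g) fun x hx =>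
      hN (show pairHom (1, x.1) ∈ gamma3Power (m + 2) from pairHom_mem_gamma3Power (one_mem _) hx)
    refine ⟨max k l + 1, ?_⟩
    rintro ⟨_, ⟨x, y⟩, ⟨hx, hy⟩, rfl⟩ h
    obtain ⟨h1, h2⟩ := pairHom_mem_levelStab.1
      (show pairHom (x, y) ∈ levelStab Bool (max k l + 1) from h)
    have hf : f ⟨x, hx⟩ ∈ N := hk (levelStab_antitone Bool (le_max_left _ _) h1)
    have hg : g ⟨y, hy⟩ ∈ N := hl (levelStab_antitone Bool (le_max_right _ _) h2)
    convert mul_mem hf hg using 1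
    apply Subtype.ext
    change pairHom (x, y) = pairHom (x, 1) * pairHom (1, y)
    rw [← map_mul]
    simp

theorem basilica_classCSP_of_gamma3Power_le (m : ℕ) : ∀ (N : Subgroup basilica) [N.Normal],
    IsFinitePGroup 2 (basilica ⧸ N) → (gamma3Power m).subgroupOf basilica ≤ N →
      ∃ n, levelStabIn basilica n ≤ N := by
  induction m with
  | zero => exact basilica_classCSPMod_gamma3.2.2
  | succ m ih =>
    intro N _ hC hN
    let j := Subgroup.inclusion (gamma3Power_le m)
    obtain ⟨k, hk⟩ := gamma3Power_classCSP m (N.comap j) (hC.comap j) fun x hx => hN hx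
    -- Intersecting `N` with `st(k)` first is the point: if `yz` lies in `st(k)` with `y` in `N ∩
    -- st(k)` and `z` in `K_m`, then `z` lies in `st(k)` too, hence in `N`.
    have hC' := (hC.inf (levelStabIn_isFinitePGroup basilica k)).of_le
      (M := N ⊓ levelStabIn basilica k ⊔ (gamma3Power m).subgroupOf basilica) le_sup_left
    obtain ⟨l, hl⟩ := ih _ hC' le_sup_right
    refine ⟨max k l, fun g hg => ?_⟩
    obtain ⟨y, hy, z, hz, rfl⟩ := Subgroup.mem_sup_of_normal_right.1
      (hl (levelStab_antitone Bool (le_max_right _ _) hg))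
    refine mul_mem hy.1 (hk (x := ⟨z.1, hz⟩) ?_)
    have h1 : y * z ∈ levelStabIn basilica k := levelStab_antitone Bool (le_max_left _ _) hg
    exact (Subgroup.mul_mem_cancel_left _ hy.2).1 h1

theorem basilica_classCSP : HasClassCSP (IsFinitePGroup 2) basilica := by
  intro N _ hC
  have := hC.1
  have hnil : Group.IsNilpotent (basilica ⧸ N) := hC.2.isNilpotent
  obtain ⟨n, hn⟩ := Subgroup.nilpotent_iff_lowerCentralSeries.1 hnil
  refine basilica_classCSP_of_gamma3Power_le n N hC fun x hx => ?_
  have h1 : x ∈ (⊤ : Subgroup basilica).lowerCentralSeries n := by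
    rw [← lowerCentralSeries_subgroupOf]
    exact Subgroup.lowerCentralSeries_antitone _ (Nat.le_add_right n 2)
      (gamma3Power_le_lowerCentralSeries n hx)
  rw [← QuotientGroup.eq_one_iff, ← QuotientGroup.mk'_apply, ← Subgroup.mem_bot, ← hn,
    ← Subgroup.map_top_of_surjective _ (QuotientGroup.mk'_surjective N),
    ← Subgroup.map_lowerCentralSeries]
  exact Subgroup.mem_map_of_mem _ h1

theorem mainTheorem5 :
    HasClassCSP (IsFinitePGroup 2) basilica ∧
      ¬ HasCSP basilica ∧
      Nonempty (Abelianization basilica ≃* Multiplicative (ℤ × ℤ)) ∧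
      HasClassCSPMod (IsFinitePGroup 2) basilica basilicaGamma3 ∧
      HasClassCSPMod (IsFinitePGroup 2) basilicaGamma3 basilicaGamma3Square :=
  ⟨basilica_classCSP, basilica_not_hasCSP, abelianization_basilica, basilica_classCSPMod_gamma3,
    gamma3_classCSPMod⟩
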